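/- Let $\mathcal{M}=(M,\nabla)$ be an affine manifold, i.e. $M$ is a smooth (Hausdorff, finite-dimensional) manifold without boundary and $\nabla$ is a smooth torsion-free connection on the tangent bundle of $M$. An affine geodesic defined on an interval $I\subseteq\mathbb{R}$ is a smooth curve $\sigma:I\to M$ with $\nabla_{\dot\sigma}\dot\sigma=0$, i.e. in all local coordinates $\ddot\sigma^i+\sum_{j,k}\Gamma_{jk}{}^i\,\dot\sigma^j\dot\sigma^k=0$ for all $i$, where $\nabla_{\partial_{x^j}}\partial_{x^k}=\sum_i\Gamma_{jk}{}^i\,\partial_{x^i}$ (derivatives at an end point belonging to $I$ are one-sided). Let $0<T<\infty$, let $P\in M$, and let $\sigma:[0,T)\to M$ be an affine geodesic such that $\lim_{t\to T^-}\sigma(t)=P$. Then there exist $\varepsilon>0$ and an affine geodesic $\tau:[0,T+\varepsilon)\to M$ with $\tau(t)=\sigma(t)$ for all $t\in[0,T)$. -/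

import Mathlib

open Set Filter Topology
open scoped Manifold ContDiff

noncomputable section

namespace AffineGeometry

/-- A connection on the tangent bundle of the `n`-dimensional manifold `M`.
In Mathlib's argument order, `nabla Y x (X x)` is `(∇_X Y)(x)`. -/
abbrev Connection (n : ℕ) (M : Type*) [TopologicalSpace M]
    [ChartedSpace (EuclideanSpace ℝ (Fin n)) M] [IsManifold (𝓡 n) ∞ M] : Type _ :=
  CovariantDerivative (𝓡 n) (EuclideanSpace ℝ (Fin n)) (TangentSpace (𝓡 n) : M → Type _)

variable {n : ℕ} {M : Type*} [TopologicalSpace M]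
  [ChartedSpace (EuclideanSpace ℝ (Fin n)) M] [IsManifold (𝓡 n) ∞ M]

/-- The connection `nabla` makes `M` an affine manifold: it is smooth (`∇_X Y` is smooth
whenever `X` and `Y` are) and torsion free (`∇_X Y - ∇_Y X = [X, Y]`). -/
structure IsAffine (nabla : Connection n M) : Prop where
  smooth : CovariantDerivative.ContMDiffCovariantDerivative nabla ∞
  torsionFree : nabla.torsion = 0

/-- The coordinate vector field `∂_j` of the chart `φ`: at each point `x` of the domain of `φ`,
the tangent vector that the differential of `φ` sends to the `j`-th standard basis vector. -/
def coordField (φ : OpenPartialHomeomorph M (EuclideanSpace ℝ (Fin n))) (j : Fin n) (x : M) :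
    TangentSpace (𝓡 n) x :=
  (mfderiv (𝓡 n) (𝓡 n) φ x).inverse (EuclideanSpace.single j (1 : ℝ) : EuclideanSpace ℝ (Fin n))

/-- The Christoffel symbol `Γ_{jk}^i` of `nabla` in the chart `φ`, at the point `x` of the domain
of `φ`: the `i`-th coordinate of `∇_{∂_j} ∂_k` at `x`. -/
def christoffel (nabla : Connection n M)
    (φ : OpenPartialHomeomorph M (EuclideanSpace ℝ (Fin n))) (j k i : Fin n) (x : M) : ℝ :=
  let w : EuclideanSpace ℝ (Fin n) :=
    mfderiv (𝓡 n) (𝓡 n) φ x (nabla (coordField φ k) x (coordField φ j x))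
  w i

/-- The curve `σ` is an affine geodesic on the interval `s` (assumed to have more than one point;
derivatives at an end point that belongs to `s` are one-sided): it is smooth on `s` and
`σ''^i + ∑ j k, Γ_{jk}^i σ'^j σ'^k = 0` in every smooth chart of `M`. -/
structure IsGeodesicOn (nabla : Connection n M) (σ : ℝ → M) (s : Set ℝ) : Prop where
  smooth : ContMDiffOn 𝓘(ℝ, ℝ) (𝓡 n) ∞ σ s
  equation : ∀ φ ∈ IsManifold.maximalAtlas (𝓡 n) ∞ M, ∀ t ∈ s, σ t ∈ φ.source → ∀ i : Fin n,
    derivWithin (fun u => derivWithin (fun v => φ (σ v) i) s u) s t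
      + ∑ j : Fin n, ∑ k : Fin n, christoffel nabla φ j k i (σ t)
          * derivWithin (fun v => φ (σ v) j) s t * derivWithin (fun v => φ (σ v) k) s t = 0

end AffineGeometry

end

/-! In a chart `φ` at `P` a geodesic is a curve `x` with `x'' = -Γ(x)(x', x')`, so near `P` the
acceleration is at most `C * ‖x'‖ ^ 2`. By ODE theory it is enough to show that the velocity has a
limit as `t → T`, given only that the position has one.

Let `p = φ P`, `f = ‖x - p‖ ^ 2` and `g = f'`. Once `x` is so close to `p` that `C * ‖x - p‖ ≤ 1/2`,
the quadratic bound yields `g' ≥ ‖x'‖ ^ 2 ≥ 0`. Hence `g` increases. It is never positive, since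
otherwise `f ≥ 0` would increase strictly from then on and could not tend to `0`. So `g` converges,
and `‖x''‖ ≤ C * g'` shows that `x'` is Cauchy (`exists_tendsto_velocity`). The local solution
through the limiting position and velocity is glued on at `T` (`exists_extension_of_tendsto`).

A geodesic has to satisfy its equation in every chart, while the extension is built in one. The
transformation law of the Christoffel symbols, `fderiv_transition_christoffelForm`, bridges this
gap. -/

namespace AffineGeometry

/-! ### Second order equations with quadratic growth in the velocity. -/

section ODE

/-- Bootstrapping: if `z` is `C^k`, then so is `z' = X ∘ z`, hence `z` is `C^(k+1)`. -/
theorem contDiffOn_infty_of_hasDerivAt {F : Type*} [NormedAddCommGroup F] [NormedSpace ℝ F]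
    {X : F → F} {U : Set F} (hX : ContDiffOn ℝ ∞ X U) {z : ℝ → F} {s : Set ℝ} (hs : IsOpen s)
    (hz : ∀ t ∈ s, HasDerivAt z (X (z t)) t) (hmem : MapsTo z s U) : ContDiffOn ℝ ∞ z s := by
  rw [contDiffOn_infty]
  intro k
  induction k with
  | zero =>
    exact contDiffOn_zero.2 fun t ht => (hz t ht).continuousAt.continuousWithinAt
  | succ k ih =>
    rw [show ((k + 1 : ℕ) : WithTop ℕ∞) = (k : WithTop ℕ∞) + 1 by push_cast; rfl,
      contDiffOn_succ_iff_deriv_of_isOpen hs]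
    refine ⟨fun t ht => (hz t ht).differentiableAt.differentiableWithinAt, by simp, ?_⟩
    have hk : ContDiffOn ℝ k X U := hX.of_le (by exact_mod_cast le_top)
    exact (hk.comp ih hmem).congr fun t ht => (hz t ht).deriv

variable {F : Type*} [NormedAddCommGroup F] [InnerProductSpace ℝ F]

/-- If a curve converges at the end of an interval and its acceleration is bounded by the square
of its velocity, then its velocity converges as well. -/
theorem exists_tendsto_velocity [CompleteSpace F] {a T C : ℝ} (haT : a < T) (hC : 0 ≤ C)
    {x v w : ℝ → F} {p : F}
    (hx : ∀ t ∈ Ioo a T, HasDerivAt x (v t) t) (hv : ∀ t ∈ Ioo a T, HasDerivAt v (w t) t)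
    (hw : ∀ t ∈ Ioo a T, ‖w t‖ ≤ C * ‖v t‖ ^ 2) (hclose : ∀ t ∈ Ioo a T, C * ‖x t - p‖ ≤ 1 / 2)
    (hlim : Tendsto x (𝓝[<] T) (𝓝 p)) : ∃ v₀, Tendsto v (𝓝[<] T) (𝓝 v₀) := by
  set f : ℝ → ℝ := fun t => ‖x t - p‖ ^ 2 with hf
  set g : ℝ → ℝ := fun t => 2 * inner ℝ (x t - p) (v t) with hg
  set g' : ℝ → ℝ := fun t => 2 * (inner ℝ (x t - p) (w t) + inner ℝ (v t) (v t)) with hg'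
  have hfd : ∀ t ∈ Ioo a T, HasDerivAt f (g t) t := fun t ht =>
    ((hx t ht).sub_const p).norm_sq
  have hgd : ∀ t ∈ Ioo a T, HasDerivAt g (g' t) t := fun t ht =>
    ((((hx t ht).sub_const p).inner ℝ (hv t ht)).const_mul 2)
  -- The term `2 * ⟪x - p, w⟫` is at least `-‖v‖ ^ 2` because `C * ‖x - p‖ ≤ 1/2`, so it costs only
  -- half of `2 * ‖v‖ ^ 2`.
  have hlow : ∀ t ∈ Ioo a T, ‖v t‖ ^ 2 ≤ g' t := by
    intro t ht
    have h1 : -(‖x t - p‖ * ‖w t‖) ≤ inner ℝ (x t - p) (w t) :=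
      neg_le_of_abs_le (abs_real_inner_le_norm _ _)
    have h2 : ‖x t - p‖ * ‖w t‖ ≤ ‖x t - p‖ * (C * ‖v t‖ ^ 2) :=
      mul_le_mul_of_nonneg_left (hw t ht) (norm_nonneg _)
    have h3 : C * ‖x t - p‖ * ‖v t‖ ^ 2 ≤ 1 / 2 * ‖v t‖ ^ 2 :=
      mul_le_mul_of_nonneg_right (hclose t ht) (sq_nonneg _)
    simp only [hg', real_inner_self_eq_norm_sq]
    linarith
  have hgcont : ∀ s ∈ Ioo a T, ∀ t ∈ Ioo a T, ContinuousOn g (Icc s t) := fun s hs t ht u hu =>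
    (hgd u ⟨hs.1.trans_le hu.1, hu.2.trans_lt ht.2⟩).continuousAt.continuousWithinAt
  have hmono : MonotoneOn g (Ioo a T) := by
    refine monotoneOn_of_deriv_nonneg (convex_Ioo a T)
      (fun t ht => (hgd t ht).continuousAt.continuousWithinAt)
      (fun t ht => (hgd t (interior_subset ht)).differentiableAt.differentiableWithinAt) ?_
    intro t ht
    rw [(hgd t (interior_subset ht)).deriv]
    exact (sq_nonneg _).trans (hlow t (interior_subset ht))
  have hf0 : Tendsto f (𝓝[<] T) (𝓝 0) := by
    have := ((hlim.sub_const p).norm).pow 2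
    simpa using this
  -- If `g t > 0`, monotonicity keeps `g` positive on `[t, T)`; then `f` increases strictly to its
  -- limit `0`, although it is nonnegative.
  have hgnonpos : ∀ t ∈ Ioo a T, g t ≤ 0 := by
    intro t ht
    by_contra! hpos
    have hsub : ∀ u ∈ Ico t T, u ∈ Ioo a T := fun u hu => ⟨ht.1.trans_le hu.1, hu.2⟩
    have hst : StrictMonoOn f (Ico t T) := by
      refine strictMonoOn_of_deriv_pos (convex_Ico t T)
        (fun u hu => (hfd u (hsub u hu)).continuousAt.continuousWithinAt) ?_
      intro u hu
      have hu' := hsub u (interior_subset hu)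
      rw [(hfd u hu').deriv]
      exact hpos.trans_le (hmono ht hu' (interior_subset hu).1)
    obtain ⟨r, hr⟩ := exists_between ht.2
    have hfr : 0 < f r := (sq_nonneg _).trans_lt
      (hst (left_mem_Ico.2 ht.2) ⟨hr.1.le, hr.2⟩ hr.1)
    have : f r ≤ 0 := by
      refine ge_of_tendsto hf0 ?_
      filter_upwards [Ioo_mem_nhdsLT hr.2] with u hu
      exact hst.monotoneOn ⟨hr.1.le, hr.2⟩ ⟨(hr.1.trans hu.1).le, hu.2⟩ hu.1.le
    exact absurd this (not_le.2 hfr)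
  have hglim := hmono.tendsto_nhdsWithin_Ioo_left (nonempty_Ioo.2 haT)
    ⟨0, by rintro _ ⟨t, ht, rfl⟩; exact hgnonpos t ht⟩
  -- Integrated form of `‖w‖ ≤ C * ‖v‖ ^ 2 ≤ C * g'`; it transfers the Cauchy property from `g` to
  -- `v`.
  have hvg : ∀ s ∈ Ioo a T, ∀ t ∈ Ioo a T, s ≤ t → ‖v t - v s‖ ≤ C * (g t - g s) := by
    intro s hs t ht hst
    have hsub : ∀ u ∈ Icc s t, u ∈ Ioo a T := fun u hu =>
      ⟨hs.1.trans_le hu.1, hu.2.trans_lt ht.2⟩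
    refine image_norm_le_of_norm_deriv_right_le_deriv_boundary' (a := s) (b := t)
      (f := fun u => v u - v s) (f' := w) (B := fun u => C * (g u - g s)) (B' := fun u => C * g' u)
      ?_ ?_ (by simp) ?_ ?_ ?_ ⟨hst, le_rfl⟩
    · exact fun u hu => ((hv u (hsub u hu)).sub_const _).continuousAt.continuousWithinAt
    · exact fun u hu => ((hv u (hsub u ⟨hu.1, hu.2.le⟩)).sub_const _).hasDerivWithinAt
    · exact fun u hu =>
        (((hgd u (hsub u hu)).sub_const _).const_mul C).continuousAt.continuousWithinAt
    · exact fun u hu =>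
        (((hgd u (hsub u ⟨hu.1, hu.2.le⟩)).sub_const _).const_mul C).hasDerivWithinAt
    · intro u hu
      have hu' := hsub u ⟨hu.1, hu.2.le⟩
      exact (hw u hu').trans (mul_le_mul_of_nonneg_left (hlow u hu') hC)
  have hdist : ∀ s ∈ Ioo a T, ∀ t ∈ Ioo a T, dist (v s) (v t) ≤ C * dist (g s) (g t) := by
    intro s hs t ht
    rcases le_total s t with h | h
    · rw [dist_comm, dist_eq_norm, dist_comm, Real.dist_eq]
      exact (hvg s hs t ht h).trans (mul_le_mul_of_nonneg_left (le_abs_self _) hC)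
    · rw [dist_eq_norm, Real.dist_eq]
      exact (hvg t ht s hs h).trans (mul_le_mul_of_nonneg_left (le_abs_self _) hC)
  have hcauchy : Cauchy (map v (𝓝[<] T)) := by
    have hgc := hglim.cauchy_map
    rw [cauchy_map_iff, Metric.uniformity_eq_comap_nhds_zero, tendsto_comap_iff] at hgc ⊢
    refine ⟨inferInstance, ?_⟩
    have hev : ∀ᶠ t in 𝓝[<] T, t ∈ Ioo a T := Ioo_mem_nhdsLT haT
    refine squeeze_zero' (Eventually.of_forall fun q => dist_nonneg) ?_
      (by simpa using hgc.2.const_mul C)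
    filter_upwards [hev.prod_mk hev] with q hq
    exact hdist q.1 hq.1 q.2 hq.2
  exact CompleteSpace.complete hcauchy

/-- A solution of a second order equation, whose right-hand side is bounded by the square of the
velocity, can be continued smoothly past a time at which its position converges. -/
theorem exists_extension_of_tendsto [CompleteSpace F] {G : F × F → F} {U : Set F} (hU : IsOpen U)
    (hG : ContDiffOn ℝ ∞ G (U ×ˢ univ)) {C : ℝ} (hGC : ∀ y ∈ U, ∀ u, ‖G (y, u)‖ ≤ C * ‖u‖ ^ 2)
    {a T : ℝ} (haT : a < T) {x v : ℝ → F} {p : F} (hp : p ∈ U) (hxU : ∀ t ∈ Ioo a T, x t ∈ U)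
    (hx : ∀ t ∈ Ioo a T, HasDerivAt x (v t) t)
    (hv : ∀ t ∈ Ioo a T, HasDerivAt v (G (x t, v t)) t)
    (hlim : Tendsto x (𝓝[<] T) (𝓝 p)) :
    ∃ ε > 0, ∃ y u : ℝ → F, ContDiffOn ℝ ∞ y (Ioo a (T + ε)) ∧
      (∀ t ∈ Ioo a (T + ε), y t ∈ U ∧ HasDerivAt y (u t) t ∧ HasDerivAt u (G (y t, u t)) t) ∧
      EqOn y x (Ioo a T) := by
  have hUo : IsOpen (U ×ˢ (univ : Set F)) := hU.prod isOpen_univ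
  obtain ⟨v₀, hv₀⟩ : ∃ v₀, Tendsto v (𝓝[<] T) (𝓝 v₀) := by
    -- The sign of `C` is not assumed, hence the absolute value.
    have hsmall : ∀ᶠ t in 𝓝[<] T, |C| * ‖x t - p‖ < 1 / 2 := by
      have h0 : Tendsto (fun t => |C| * ‖x t - p‖) (𝓝[<] T) (𝓝 0) := by
        simpa using ((hlim.sub_const p).norm).const_mul |C|
      exact h0.eventually (gt_mem_nhds (by norm_num))
    obtain ⟨b, hb, hbs⟩ := (mem_nhdsLT_iff_exists_mem_Ico_Ioo_subset haT).1 hsmall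
    have hsub : ∀ t ∈ Ioo b T, t ∈ Ioo a T := fun t ht => ⟨hb.1.trans_lt ht.1, ht.2⟩
    refine exists_tendsto_velocity hb.2 (abs_nonneg C) (fun t ht => hx t (hsub t ht))
      (fun t ht => hv t (hsub t ht)) (fun t ht => ?_) (fun t ht => (hbs ht).le) hlim
    exact (hGC _ (hxU t (hsub t ht)) _).trans
      (mul_le_mul_of_nonneg_right (le_abs_self C) (sq_nonneg _))
  set X : F × F → F × F := fun q => (q.2, G q) with hX
  have hXs : ContDiffOn ℝ ∞ X (U ×ˢ univ) := contDiff_snd.contDiffOn.prodMk hG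
  have hz₀ : (p, v₀) ∈ U ×ˢ (univ : Set F) := ⟨hp, mem_univ _⟩
  have hXat : ContDiffAt ℝ ∞ X (p, v₀) := hXs.contDiffAt (hUo.mem_nhds hz₀)
  obtain ⟨α, hα0, δ, hδ, hα⟩ :=
    ContDiffAt.exists_forall_mem_closedBall_exists_eq_forall_mem_Ioo_hasDerivAt₀
      (hXat.of_le (by simp)) T
  have hαT : ContinuousAt α T := (hα T ⟨by linarith, by linarith⟩).continuousAt
  have hαU : ∀ᶠ t in 𝓝 T, α t ∈ U ×ˢ (univ : Set F) :=
    hαT.eventually (by rw [hα0]; exact hUo.mem_nhds hz₀)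
  obtain ⟨η, hη, hηU⟩ := Metric.eventually_nhds_iff.1 hαU
  -- `δ` bounds the existence time of the local solution `α`, and `η` the time during which its
  -- position stays in `U`.
  set ε := min δ η with hε
  have hεpos : 0 < ε := lt_min hδ hη
  set z : ℝ → F × F := fun t => if t < T then (x t, v t) else α t with hz
  have hzl : ∀ t, t < T → z t = (x t, v t) := fun t ht => if_pos ht
  have hzr : ∀ t, T ≤ t → z t = α t := fun t ht => if_neg (not_lt.2 ht)
  have hzU : MapsTo z (Ioo a (T + ε)) (U ×ˢ univ) := by
    intro t ht
    rcases lt_or_ge t T with h | h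
    · rw [hzl t h]; exact ⟨hxU t ⟨ht.1, h⟩, mem_univ _⟩
    · rw [hzr t h]
      apply hηU
      rw [Real.dist_eq, abs_of_nonneg (by linarith)]
      linarith [ht.2, min_le_right δ η]
  have hzlt : ∀ t ∈ Ioo a T, HasDerivAt z (X (z t)) t := by
    intro t ht
    have hev : z =ᶠ[𝓝 t] fun t => (x t, v t) := by
      filter_upwards [Iio_mem_nhds ht.2] with s hs using hzl s hs
    rw [hzl t ht.2]
    exact ((hx t ht).prodMk (hv t ht)).congr_of_eventuallyEq hev
  have hzlim : Tendsto z (𝓝[<] T) (𝓝 (p, v₀)) := by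
    refine (hlim.prodMk_nhds hv₀).congr' ?_
    filter_upwards [self_mem_nhdsWithin] with t ht using (hzl t ht).symm
  have hzT : z T = (p, v₀) := by rw [hzr T le_rfl, hα0]
  have hzd : ∀ t ∈ Ioo a (T + ε), HasDerivAt z (X (z t)) t := by
    intro t ht
    rcases lt_trichotomy t T with h | rfl | h
    · exact hzlt t ⟨ht.1, h⟩
    · rw [← hasDerivWithinAt_univ, ← Iic_union_Ici]
      refine HasDerivWithinAt.union ?_ ?_
      -- At the gluing time the left derivative is the limit of `z' = X ∘ z` from the left, which is
      -- `X (p, v₀)` by continuity of `X`; the right derivative comes from `α`.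
      · refine hasDerivWithinAt_Iic_of_tendsto_deriv (s := Ioo a t)
          (fun s hs => (hzlt s hs).differentiableAt.differentiableWithinAt) ?_
          (Ioo_mem_nhdsLT haT) ?_
        · rw [ContinuousWithinAt, hzT]
          exact hzlim.mono_left (nhdsWithin_mono _ fun s hs => hs.2)
        · rw [hzT]
          refine (hXat.continuousAt.tendsto.comp hzlim).congr' ?_
          filter_upwards [Ioo_mem_nhdsLT haT] with s hs using (hzlt s hs).deriv.symm
      · rw [hzr t le_rfl]
        exact (hα t ⟨by linarith, by linarith⟩).hasDerivWithinAt.congr (fun s hs => hzr s hs)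
          (hzr t le_rfl)
    · have hev : z =ᶠ[𝓝 t] α := by
        filter_upwards [Ioi_mem_nhds h] with s hs using hzr s (le_of_lt hs)
      rw [hzr t h.le]
      exact (hα t ⟨by linarith, by linarith [ht.2, min_le_left δ η]⟩).congr_of_eventuallyEq hev
  refine ⟨ε, hεpos, fun t => (z t).1, fun t => (z t).2, ?_, ?_, ?_⟩
  · exact contDiff_fst.comp_contDiffOn (contDiffOn_infty_of_hasDerivAt hXs isOpen_Ioo hzd hzU)
  · intro t ht
    exact ⟨(hzU ht).1, (hzd t ht).fst, (hzd t ht).snd⟩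
  · intro t ht
    simp only [hzl t ht.2]

end ODE

end AffineGeometry

namespace AffineGeometry

/-! ### Charts, transition maps and coordinate fields. -/

section Charts

variable {n : ℕ} {M : Type*} [TopologicalSpace M]
  [ChartedSpace (EuclideanSpace ℝ (Fin n)) M]
  {φ ψ : OpenPartialHomeomorph M (EuclideanSpace ℝ (Fin n))} {x : M}

theorem mdifferentiable_of_mem_maximalAtlas (hφ : φ ∈ IsManifold.maximalAtlas (𝓡 n) ∞ M) :
    φ.MDifferentiable (𝓡 n) (𝓡 n) :=
  ⟨(contMDiffOn_of_mem_maximalAtlas hφ).mdifferentiableOn (by simp),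
    (contMDiffOn_symm_of_mem_maximalAtlas hφ).mdifferentiableOn (by simp)⟩

theorem contDiffAt_transition (hφ : φ ∈ IsManifold.maximalAtlas (𝓡 n) ∞ M)
    (hψ : ψ ∈ IsManifold.maximalAtlas (𝓡 n) ∞ M) (hx : x ∈ φ.source) (hx' : x ∈ ψ.source) :
    ContDiffAt ℝ ∞ (ψ ∘ φ.symm) (φ x) := by
  rw [← contMDiffAt_iff_contDiffAt]
  refine ContMDiffAt.comp (φ x) ?_ (contMDiffAt_symm_of_mem_maximalAtlas hφ (φ.map_source hx))
  rw [φ.left_inv hx]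
  exact contMDiffAt_of_mem_maximalAtlas hψ hx'

theorem isInvertible_mfderiv_chart (hφ : φ ∈ IsManifold.maximalAtlas (𝓡 n) ∞ M)
    (hx : x ∈ φ.source) : (mfderiv (𝓡 n) (𝓡 n) φ x).IsInvertible :=
  ⟨(mdifferentiable_of_mem_maximalAtlas hφ).mfderiv hx, rfl⟩

theorem mfderiv_chart_inverse (hφ : φ ∈ IsManifold.maximalAtlas (𝓡 n) ∞ M)
    (hx : x ∈ φ.source) (w : TangentSpace (𝓡 n) (φ x)) :
    mfderiv (𝓡 n) (𝓡 n) φ x ((mfderiv (𝓡 n) (𝓡 n) φ x).inverse w) = w := by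
  obtain ⟨e, he⟩ := isInvertible_mfderiv_chart hφ hx
  rw [← he, ContinuousLinearMap.inverse_equiv]
  exact e.apply_symm_apply w

theorem inverse_mfderiv_chart (hφ : φ ∈ IsManifold.maximalAtlas (𝓡 n) ∞ M)
    (hx : x ∈ φ.source) (u : TangentSpace (𝓡 n) x) :
    (mfderiv (𝓡 n) (𝓡 n) φ x).inverse (mfderiv (𝓡 n) (𝓡 n) φ x u) = u := by
  obtain ⟨e, he⟩ := isInvertible_mfderiv_chart hφ hx
  rw [← he, ContinuousLinearMap.inverse_equiv]
  exact e.symm_apply_apply u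

theorem mfderiv_chart_eq_transition (hφ : φ ∈ IsManifold.maximalAtlas (𝓡 n) ∞ M)
    (hψ : ψ ∈ IsManifold.maximalAtlas (𝓡 n) ∞ M) (hx : x ∈ φ.source) (hx' : x ∈ ψ.source)
    (u : TangentSpace (𝓡 n) x) :
    mfderiv (𝓡 n) (𝓡 n) ψ x u =
      fderiv ℝ (ψ ∘ φ.symm) (φ x) (mfderiv (𝓡 n) (𝓡 n) φ x u) := by
  have hev : ψ =ᶠ[𝓝 x] (ψ ∘ φ.symm) ∘ φ := by
    filter_upwards [φ.open_source.mem_nhds hx] with y hy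
    simp [φ.left_inv hy]
  have hg : MDifferentiableAt (𝓡 n) (𝓡 n) (ψ ∘ φ.symm) (φ x) :=
    ((contDiffAt_transition hφ hψ hx hx').differentiableAt (by simp)).mdifferentiableAt
  rw [hev.mfderiv_eq, mfderiv_comp x hg
    ((mdifferentiable_of_mem_maximalAtlas hφ).mdifferentiableAt hx), mfderiv_eq_fderiv]
  rfl

theorem mfderiv_chart_inverse_eq_transition (hφ : φ ∈ IsManifold.maximalAtlas (𝓡 n) ∞ M)
    (hψ : ψ ∈ IsManifold.maximalAtlas (𝓡 n) ∞ M) (hx : x ∈ φ.source) (hx' : x ∈ ψ.source)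
    (w : EuclideanSpace ℝ (Fin n)) :
    mfderiv (𝓡 n) (𝓡 n) ψ x ((mfderiv (𝓡 n) (𝓡 n) φ x).inverse w) =
      fderiv ℝ (ψ ∘ φ.symm) (φ x) w := by
  rw [mfderiv_chart_eq_transition hφ hψ hx hx']
  exact congrArg _ (mfderiv_chart_inverse hφ hx w)

variable [IsManifold (𝓡 n) ∞ M]

/-- Turns smoothness of vector fields, which is tested in bundle trivializations, into a statement
about differentials of charts. -/
theorem trivializationAt_tangent_apply {x₀ y : M}
    (hy : y ∈ (chartAt (EuclideanSpace ℝ (Fin n)) x₀).source) (u : TangentSpace (𝓡 n) y) :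
    (trivializationAt (EuclideanSpace ℝ (Fin n)) (TangentSpace (𝓡 n)) x₀ ⟨y, u⟩).2 =
      mfderiv (𝓡 n) (𝓡 n) (chartAt (EuclideanSpace ℝ (Fin n)) x₀) y u := by
  have h := TangentBundle.continuousLinearMapAt_trivializationAt (I := 𝓡 n) hy
  have h' := DFunLike.congr_fun h u
  rw [Bundle.Trivialization.continuousLinearMapAt_apply,
    Bundle.Trivialization.coe_linearMapAt_of_mem _ (by simpa using hy)] at h'
  exact h'

/-- Read in the preferred chart `χ` at `x`, the field is a column of the Jacobian of the smooth
transition map `χ ∘ φ.symm`. -/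
theorem contMDiffAt_coordField (hφ : φ ∈ IsManifold.maximalAtlas (𝓡 n) ∞ M)
    (hx : x ∈ φ.source) (k : Fin n) :
    ContMDiffAt (𝓡 n) ((𝓡 n).prod 𝓘(ℝ, EuclideanSpace ℝ (Fin n))) ∞
      (fun y => Bundle.TotalSpace.mk' (EuclideanSpace ℝ (Fin n)) (E := TangentSpace (𝓡 n)) y
        (coordField φ k y)) x := by
  rw [Bundle.contMDiffAt_section]
  set χ := chartAt (EuclideanSpace ℝ (Fin n)) x with hχ
  have hχm : χ ∈ IsManifold.maximalAtlas (𝓡 n) ∞ M := IsManifold.chart_mem_maximalAtlas x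
  have hxχ : x ∈ χ.source := mem_chart_source _ x
  have hev : (fun y => (trivializationAt (EuclideanSpace ℝ (Fin n)) (TangentSpace (𝓡 n)) x
        ⟨y, coordField φ k y⟩).2) =ᶠ[𝓝 x]
      fun y => fderiv ℝ (χ ∘ φ.symm) (φ y) (EuclideanSpace.single k (1 : ℝ)) := by
    filter_upwards [φ.open_source.mem_nhds hx, χ.open_source.mem_nhds hxχ] with y hy hy'
    rw [trivializationAt_tangent_apply hy']
    exact mfderiv_chart_inverse_eq_transition hφ hχm hy hy' _
  refine ContMDiffAt.congr_of_eventuallyEq ?_ hev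
  have h1 : ContDiffAt ℝ ∞ (fun q => fderiv ℝ (χ ∘ φ.symm) q
      (EuclideanSpace.single k (1 : ℝ) : EuclideanSpace ℝ (Fin n))) (φ x) :=
    ((contDiffAt_transition hφ hχm hx hxχ).fderiv_right (by simp)).clm_apply contDiffAt_const
  exact h1.contMDiffAt.comp x (contMDiffAt_of_mem_maximalAtlas hφ hx)

end Charts

end AffineGeometry

namespace AffineGeometry

/-! ### Christoffel symbols: transformation law and smoothness. -/

section Christoffel

variable {n : ℕ} {M : Type*} [TopologicalSpace M]
  [ChartedSpace (EuclideanSpace ℝ (Fin n)) M] [IsManifold (𝓡 n) ∞ M]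
  {φ ψ : OpenPartialHomeomorph M (EuclideanSpace ℝ (Fin n))} {x : M}

/-- The coordinate vector of `∇_{∂_j} ∂_k`, whose components are the Christoffel symbols. -/
noncomputable def christoffelVec (nabla : Connection n M)
    (φ : OpenPartialHomeomorph M (EuclideanSpace ℝ (Fin n))) (j k : Fin n) (x : M) :
    EuclideanSpace ℝ (Fin n) :=
  mfderiv (𝓡 n) (𝓡 n) φ x (nabla (coordField φ k) x (coordField φ j x))

theorem christoffel_eq (nabla : Connection n M)
    (φ : OpenPartialHomeomorph M (EuclideanSpace ℝ (Fin n))) (j k i : Fin n) (x : M) :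
    christoffel nabla φ j k i x = christoffelVec nabla φ j k x i := rfl

/-- The bilinear map with coefficients the Christoffel symbols. -/
noncomputable def christoffelForm (nabla : Connection n M)
    (φ : OpenPartialHomeomorph M (EuclideanSpace ℝ (Fin n))) (x : M)
    (v w : EuclideanSpace ℝ (Fin n)) : EuclideanSpace ℝ (Fin n) :=
  ∑ j, ∑ k, (v j * w k) • christoffelVec nabla φ j k x

theorem christoffelForm_apply (nabla : Connection n M)
    (φ : OpenPartialHomeomorph M (EuclideanSpace ℝ (Fin n))) (x : M)
    (v w : EuclideanSpace ℝ (Fin n)) (i : Fin n) :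
    christoffelForm nabla φ x v w i =
      ∑ j, ∑ k, christoffel nabla φ j k i x * v j * w k := by
  simp only [christoffelForm, christoffel_eq, WithLp.ofLp_sum, Finset.sum_apply, WithLp.ofLp_smul,
    Pi.smul_apply, smul_eq_mul]
  exact Finset.sum_congr rfl fun j _ => Finset.sum_congr rfl fun k _ => by ring

theorem nabla_sum_smul (nabla : Connection n M) {ι : Type*} (s : Finset ι) {h : ι → M → ℝ}
    {S : ι → Π y : M, TangentSpace (𝓡 n) y}
    (hh : ∀ i, MDifferentiableAt (𝓡 n) 𝓘(ℝ, ℝ) (h i) x)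
    (hS : ∀ i, MDifferentiableAt (𝓡 n) ((𝓡 n).prod 𝓘(ℝ, EuclideanSpace ℝ (Fin n)))
      (fun y => Bundle.TotalSpace.mk' (EuclideanSpace ℝ (Fin n)) (E := TangentSpace (𝓡 n)) y
        (S i y)) x) :
    nabla (fun y => ∑ i ∈ s, h i y • S i y) x =
      ∑ i ∈ s, (h i x • nabla (S i) x + (mvfderiv (𝓡 n) (h i) x).smulRight (S i x)) := by
  classical
  induction s using Finset.induction_on with
  | empty =>
    exact nabla.isCovariantDerivativeOnUniv.zero
  | insert i s hi ih =>
    have hsm : ∀ i, MDifferentiableAt (𝓡 n) ((𝓡 n).prod 𝓘(ℝ, EuclideanSpace ℝ (Fin n)))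
        (fun y => Bundle.TotalSpace.mk' (EuclideanSpace ℝ (Fin n)) (E := TangentSpace (𝓡 n)) y
          ((h i • S i) y)) x := fun i => (hh i).smul_section (hS i)
    have hsplit : (fun y => ∑ i ∈ insert i s, h i y • S i y) =
        h i • S i + fun y => ∑ i ∈ s, h i y • S i y := by
      funext y
      simp [Finset.sum_insert hi]
    rw [hsplit, Finset.sum_insert hi, ← ih,
      nabla.isCovariantDerivativeOnUniv.add (hsm i)
        (MDifferentiableAt.sum_section (t := fun i y => h i y • S i y) fun i _ => hsm i),
      nabla.isCovariantDerivativeOnUniv.leibniz (hS i) (hh i)]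

theorem mdifferentiableAt_coordField (hφ : φ ∈ IsManifold.maximalAtlas (𝓡 n) ∞ M)
    (hx : x ∈ φ.source) (k : Fin n) :
    MDifferentiableAt (𝓡 n) ((𝓡 n).prod 𝓘(ℝ, EuclideanSpace ℝ (Fin n)))
      (fun y => Bundle.TotalSpace.mk' (EuclideanSpace ℝ (Fin n)) (E := TangentSpace (𝓡 n)) y
        (coordField φ k y)) x :=
  (contMDiffAt_coordField hφ hx k).mdifferentiableAt (by simp)

omit [IsManifold (𝓡 n) ∞ M] in
theorem sum_smul_coordField (hφ : φ ∈ IsManifold.maximalAtlas (𝓡 n) ∞ M) (hx : x ∈ φ.source)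
    (u : TangentSpace (𝓡 n) x) (c : EuclideanSpace ℝ (Fin n))
    (hc : mfderiv (𝓡 n) (𝓡 n) φ x u = c) : u = ∑ l, c l • coordField φ l x := by
  have hsum : c = ∑ l, c l • (EuclideanSpace.single l (1 : ℝ) : EuclideanSpace ℝ (Fin n)) := by
    simpa using ((EuclideanSpace.basisFun (Fin n) ℝ).sum_repr c).symm
  rw [← inverse_mfderiv_chart hφ hx u, hc]
  conv_lhs => rw [hsum]
  refine (map_sum (mfderiv (𝓡 n) (𝓡 n) φ x).inverse _ _).trans ?_
  exact Finset.sum_congr rfl fun l _ => map_smul (mfderiv (𝓡 n) (𝓡 n) φ x).inverse _ _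

/-- The transformation law of the Christoffel symbols on coordinate fields. -/
theorem fderiv_transition_christoffelVec (nabla : Connection n M)
    (hφ : φ ∈ IsManifold.maximalAtlas (𝓡 n) ∞ M) (hψ : ψ ∈ IsManifold.maximalAtlas (𝓡 n) ∞ M)
    (hx : x ∈ φ.source) (hx' : x ∈ ψ.source) (j k : Fin n) :
    fderiv ℝ (ψ ∘ φ.symm) (φ x) (christoffelVec nabla φ j k x) =
      fderiv ℝ (fderiv ℝ (ψ ∘ φ.symm)) (φ x) (EuclideanSpace.single j 1)
        (EuclideanSpace.single k 1) +
      christoffelForm nabla ψ x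
        (fderiv ℝ (ψ ∘ φ.symm) (φ x) (EuclideanSpace.single j 1))
        (fderiv ℝ (ψ ∘ φ.symm) (φ x) (EuclideanSpace.single k 1)) := by
  set g := ψ ∘ φ.symm with hg
  set e : Fin n → EuclideanSpace ℝ (Fin n) := fun j => EuclideanSpace.single j 1 with he
  have hgs : ContDiffAt ℝ ∞ g (φ x) := contDiffAt_transition hφ hψ hx hx'
  have hDg : DifferentiableAt ℝ (fderiv ℝ g) (φ x) :=
    (hgs.fderiv_right (m := ∞) (by simp)).differentiableAt (by simp)
  have hφd : MDifferentiableAt (𝓡 n) (𝓡 n) φ x :=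
    (mdifferentiable_of_mem_maximalAtlas hφ).mdifferentiableAt hx
  -- The coefficients of the field `∂_k` of `φ` in the coordinate frame of `ψ`.
  set h : Fin n → M → ℝ := fun l y => fderiv ℝ g (φ y) (e k) l with hh
  set H : Fin n → EuclideanSpace ℝ (Fin n) → ℝ := fun l q => fderiv ℝ g q (e k) l with hH
  have hHd : ∀ l, HasFDerivAt (H l)
      ((EuclideanSpace.proj l : EuclideanSpace ℝ (Fin n) →L[ℝ] ℝ).comp
        ((fderiv ℝ (fderiv ℝ g) (φ x)).flip (e k))) (φ x) := by
    intro l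
    have h1 : HasFDerivAt (fun q => fderiv ℝ g q (e k))
        ((fderiv ℝ (fderiv ℝ g) (φ x)).flip (e k)) (φ x) := by
      have := hDg.hasFDerivAt.clm_apply (hasFDerivAt_const (e k) (φ x))
      simpa only [ContinuousLinearMap.comp_zero, zero_add] using this
    exact (EuclideanSpace.proj l : EuclideanSpace ℝ (Fin n) →L[ℝ] ℝ).hasFDerivAt.comp (φ x) h1
  have hhd : ∀ l, MDifferentiableAt (𝓡 n) 𝓘(ℝ, ℝ) (h l) x := fun l =>
    (hHd l).differentiableAt.mdifferentiableAt.comp x hφd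
  -- Differentiating these coefficients along `∂_j` produces the inhomogeneous second derivative
  -- term of the law.
  have hdir : ∀ l, mvfderiv (𝓡 n) (h l) x (coordField φ j x) =
      fderiv ℝ (fderiv ℝ g) (φ x) (e j) (e k) l := by
    intro l
    have h1 : mfderiv (𝓡 n) 𝓘(ℝ, ℝ) (h l) x =
        (mfderiv (𝓡 n) 𝓘(ℝ, ℝ) (H l) (φ x)).comp (mfderiv (𝓡 n) (𝓡 n) φ x) :=
      mfderiv_comp x (hHd l).differentiableAt.mdifferentiableAt hφd
    have h2 : mfderiv (𝓡 n) (𝓡 n) φ x (coordField φ j x) = e j :=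
      mfderiv_chart_inverse hφ hx _
    have h3 : mfderiv (𝓡 n) 𝓘(ℝ, ℝ) (h l) x (coordField φ j x) =
        (fderiv ℝ (H l) (φ x) (e j) : ℝ) := by
      rw [h1, mfderiv_eq_fderiv]
      exact congrArg _ h2
    have h4 : fderiv ℝ (H l) (φ x) (e j) = fderiv ℝ (fderiv ℝ g) (φ x) (e j) (e k) l := by
      rw [(hHd l).fderiv]
      rfl
    exact h3.trans h4
  have hframe : ∀ y ∈ φ.source, y ∈ ψ.source →
      coordField φ k y = ∑ l, h l y • coordField ψ l y := fun y hy hy' =>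
    sum_smul_coordField hψ hy' _ _ (mfderiv_chart_inverse_eq_transition hφ hψ hy hy' _)
  have hSd := fun l => mdifferentiableAt_coordField hψ hx' l
  -- The frame expansion holds only near `x`, which suffices because a covariant derivative is
  -- local; the Leibniz rule does the rest.
  have hcov : nabla (coordField φ k) x = ∑ l, (h l x • nabla (coordField ψ l) x +
      (mvfderiv (𝓡 n) (h l) x).smulRight (coordField ψ l x)) := by
    rw [← nabla_sum_smul nabla Finset.univ hhd hSd]
    refine nabla.isCovariantDerivativeOnUniv.congr_of_eventuallyEq
      (mdifferentiableAt_coordField hφ hx k)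
      (MDifferentiableAt.sum_section (t := fun i y => h i y • coordField ψ i y)
        fun l _ => (hhd l).smul_section (hSd l)) univ_mem ?_
    filter_upwards [φ.open_source.mem_nhds hx, ψ.open_source.mem_nhds hx'] with y hy hy'
      using hframe y hy hy'
  set u := coordField φ j x with hu
  set L : TangentSpace (𝓡 n) x →L[ℝ] EuclideanSpace ℝ (Fin n) := mfderiv (𝓡 n) (𝓡 n) ψ x with hL
  have hLu : L u = fderiv ℝ g (φ x) (e j) := mfderiv_chart_inverse_eq_transition hφ hψ hx hx' _
  have hu_sum : u = ∑ m, (fderiv ℝ g (φ x) (e j)) m • coordField ψ m x :=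
    sum_smul_coordField hψ hx' u _ hLu
  have hLcov : ∀ l, L (nabla (coordField ψ l) x u) =
      ∑ m, (fderiv ℝ g (φ x) (e j)) m • christoffelVec nabla ψ m l x := by
    intro l
    rw [hu_sum, map_sum, map_sum]
    refine Finset.sum_congr rfl fun m _ => ?_
    rw [map_smul, map_smul]
    rfl
  have hLe : ∀ l, L (coordField ψ l x) = e l := fun l => mfderiv_chart_inverse hψ hx' _
  have hstart : fderiv ℝ g (φ x) (christoffelVec nabla φ j k x) =
      L (nabla (coordField φ k) x u) :=
    (mfderiv_chart_eq_transition hφ hψ hx hx' _).symm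
  have hexp : L (nabla (coordField φ k) x u) =
      ∑ l, (h l x • L (nabla (coordField ψ l) x u) +
        fderiv ℝ (fderiv ℝ g) (φ x) (e j) (e k) l • L (coordField ψ l x)) := by
    rw [hcov, _root_.sum_apply, map_sum]
    refine Finset.sum_congr rfl fun l _ => ?_
    rw [_root_.add_apply, ContinuousLinearMap.smulRight_apply, hdir,
      _root_.smul_apply, map_add, map_smul, map_smul]
  rw [hstart, hexp, Finset.sum_add_distrib, add_comm]
  congr 1
  · simp_rw [hLe]
    simpa using (EuclideanSpace.basisFun (Fin n) ℝ).sum_repr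
      (fderiv ℝ (fderiv ℝ g) (φ x) (e j) (e k))
  · rw [christoffelForm, Finset.sum_comm]
    refine Finset.sum_congr rfl fun l _ => ?_
    rw [hLcov, Finset.smul_sum]
    refine Finset.sum_congr rfl fun m _ => ?_
    rw [smul_smul, mul_comm]

theorem christoffelForm_sum_smul (nabla : Connection n M)
    (φ : OpenPartialHomeomorph M (EuclideanSpace ℝ (Fin n))) (x : M)
    (c d : Fin n → ℝ) (V W : Fin n → EuclideanSpace ℝ (Fin n)) :
    christoffelForm nabla φ x (∑ j, c j • V j) (∑ k, d k • W k) =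
      ∑ j, ∑ k, (c j * d k) • christoffelForm nabla φ x (V j) (W k) := by
  have hB : ∃ B : EuclideanSpace ℝ (Fin n) →ₗ[ℝ] EuclideanSpace ℝ (Fin n) →ₗ[ℝ]
      EuclideanSpace ℝ (Fin n), ∀ v w, B v w = christoffelForm nabla φ x v w := by
    refine ⟨LinearMap.mk₂ ℝ (christoffelForm nabla φ x) ?_ ?_ ?_ ?_, fun v w => rfl⟩ <;>
    · intros
      simp [christoffelForm, add_mul, mul_add, add_smul, Finset.sum_add_distrib, Finset.smul_sum,
        smul_smul, mul_assoc, mul_left_comm]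
  obtain ⟨B, hB⟩ := hB
  simp only [← hB, map_sum, map_smul, LinearMap.sum_apply, LinearMap.smul_apply, Finset.smul_sum,
    smul_smul]
  rw [Finset.sum_comm]
  simp only [mul_comm]

/-- The transformation law of the Christoffel symbols. -/
theorem fderiv_transition_christoffelForm (nabla : Connection n M)
    (hφ : φ ∈ IsManifold.maximalAtlas (𝓡 n) ∞ M) (hψ : ψ ∈ IsManifold.maximalAtlas (𝓡 n) ∞ M)
    (hx : x ∈ φ.source) (hx' : x ∈ ψ.source) (v w : EuclideanSpace ℝ (Fin n)) :
    fderiv ℝ (ψ ∘ φ.symm) (φ x) (christoffelForm nabla φ x v w) =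
      fderiv ℝ (fderiv ℝ (ψ ∘ φ.symm)) (φ x) v w +
      christoffelForm nabla ψ x (fderiv ℝ (ψ ∘ φ.symm) (φ x) v)
        (fderiv ℝ (ψ ∘ φ.symm) (φ x) w) := by
  have hsum : ∀ c : EuclideanSpace ℝ (Fin n),
      c = ∑ l, c l • (EuclideanSpace.single l (1 : ℝ) : EuclideanSpace ℝ (Fin n)) := fun c => by
    simpa using ((EuclideanSpace.basisFun (Fin n) ℝ).sum_repr c).symm
  set A := fderiv ℝ (ψ ∘ φ.symm) (φ x) with hA
  set D := fderiv ℝ (fderiv ℝ (ψ ∘ φ.symm)) (φ x) with hD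
  have h1 : ∀ c, A c = ∑ l, c l • A (EuclideanSpace.single l (1 : ℝ)) := fun c => by
    conv_lhs => rw [hsum c]
    simp only [map_sum, map_smul]
  have h2 : D v w = ∑ j, ∑ k, (v j * w k) •
      D (EuclideanSpace.single j (1 : ℝ)) (EuclideanSpace.single k (1 : ℝ)) := by
    conv_lhs => rw [hsum v, hsum w]
    simp only [map_sum, map_smul, _root_.sum_apply, _root_.smul_apply,
      Finset.smul_sum, smul_smul]
    rw [Finset.sum_comm]
    simp only [mul_comm]
  rw [h2, h1 v, h1 w, christoffelForm_sum_smul, ← Finset.sum_add_distrib, christoffelForm, map_sum]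
  refine Finset.sum_congr rfl fun j _ => ?_
  rw [map_sum, ← Finset.sum_add_distrib]
  refine Finset.sum_congr rfl fun k _ => ?_
  rw [map_smul, hA, fderiv_transition_christoffelVec nabla hφ hψ hx hx', smul_add]

/-- Near the centre of a preferred chart the Christoffel symbols are smooth. -/
theorem exists_contMDiffOn_christoffelVec [T2Space M] {nabla : Connection n M}
    (hnabla : CovariantDerivative.ContMDiffCovariantDerivative nabla ∞) (P : M) :
    ∃ W : Set M, IsOpen W ∧ P ∈ W ∧ W ⊆ (chartAt (EuclideanSpace ℝ (Fin n)) P).source ∧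
      ∀ j k, ContMDiffOn (𝓡 n) 𝓘(ℝ, EuclideanSpace ℝ (Fin n)) ∞
        (christoffelVec nabla (chartAt (EuclideanSpace ℝ (Fin n)) P) j k) W := by
  set φ := chartAt (EuclideanSpace ℝ (Fin n)) P with hφd
  have hφ : φ ∈ IsManifold.maximalAtlas (𝓡 n) ∞ M := IsManifold.chart_mem_maximalAtlas P
  have hfr : ∀ k, ContMDiffOn (𝓡 n) ((𝓡 n).prod 𝓘(ℝ, EuclideanSpace ℝ (Fin n))) ∞
      (fun y => Bundle.TotalSpace.mk' (EuclideanSpace ℝ (Fin n)) (E := TangentSpace (𝓡 n)) y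
        (coordField φ k y)) φ.source := fun k y hy =>
    (contMDiffAt_coordField hφ hy k).contMDiffWithinAt
  obtain ⟨f⟩ : Nonempty (SmoothBumpFunction (𝓡 n) P) := inferInstance
  -- Smoothness of `nabla` is applied to global fields, so the coordinate fields are cut off by a
  -- bump function. On `W` the cut-off changes nothing, and by locality neither does it change
  -- `nabla`.
  set W := interior {y | f y = 1} ∩ φ.source with hW
  have hWo : IsOpen W := isOpen_interior.inter φ.open_source
  refine ⟨W, hWo, ⟨mem_interior_iff_mem_nhds.2 f.eventuallyEq_one,
    mem_chart_source _ P⟩, inter_subset_right, fun j k => ?_⟩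
  have hglob : ContMDiff (𝓡 n) ((𝓡 n).prod 𝓘(ℝ, EuclideanSpace ℝ (Fin n))) ∞
      (fun y => Bundle.TotalSpace.mk' (EuclideanSpace ℝ (Fin n)) (E := TangentSpace (𝓡 n)) y
        (((f : M → ℝ) • coordField φ k) y)) :=
    ContMDiffOn.smul_section_of_tsupport f.contMDiff.contMDiffOn φ.open_source
      f.tsupport_subset_chartAt_source (hfr k)
  have hcov := hnabla.contMDiff.contMDiff (σ := (f : M → ℝ) • coordField φ k)
    (by simpa using hglob.contMDiffOn)
  rw [contMDiffOn_univ] at hcov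
  have happ : ContMDiffOn (𝓡 n) ((𝓡 n).prod 𝓘(ℝ, EuclideanSpace ℝ (Fin n))) ∞
      (fun y => Bundle.TotalSpace.mk' (EuclideanSpace ℝ (Fin n)) (E := TangentSpace (𝓡 n)) y
        (nabla ((f : M → ℝ) • coordField φ k) y (coordField φ j y))) W :=
    ContMDiffOn.clm_bundle_apply hcov.contMDiffOn ((hfr j).mono inter_subset_right)
  rw [(trivializationAt (EuclideanSpace ℝ (Fin n)) (TangentSpace (𝓡 n)) P).contMDiffOn_section_iff
    hWo (fun y hy => by simpa using hy.2)] at happ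
  refine happ.congr fun y hy => ?_
  rw [trivializationAt_tangent_apply hy.2, christoffelVec]
  have hev : ∀ᶠ z in 𝓝 y, coordField φ k z = ((f : M → ℝ) • coordField φ k) z := by
    filter_upwards [isOpen_interior.mem_nhds hy.1] with z hz
    have hz1 : z ∈ {y | f y = 1} := interior_subset hz
    rw [mem_ofPred_eq] at hz1
    simp [hz1]
  rw [nabla.isCovariantDerivativeOnUniv.congr_of_eventuallyEq
    (mdifferentiableAt_coordField hφ hy.2 k) ((hglob y).mdifferentiableAt (by simp)) univ_mem hev]

end Christoffel

end AffineGeometry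

namespace AffineGeometry

/-! ### The geodesic equation in charts. -/

section Geodesics

variable {n : ℕ}

theorem derivWithin_component {c v : ℝ → EuclideanSpace ℝ (Fin n)} {a : EuclideanSpace ℝ (Fin n)}
    {s : Set ℝ} {t : ℝ} (hs : s ∈ 𝓝 t) (hc : ∀ᶠ u in 𝓝 t, HasDerivAt c (v u) u)
    (hv : HasDerivAt v a t) (i : Fin n) :
    derivWithin (fun u => c u i) s t = v t i ∧
      derivWithin (fun u => derivWithin (fun w => c w i) s u) s t = a i := by
  have hproj : ∀ {f : ℝ → EuclideanSpace ℝ (Fin n)} {f' : EuclideanSpace ℝ (Fin n)} {u : ℝ},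
      HasDerivAt f f' u → HasDerivAt (fun w => f w i) (f' i) u := fun hf =>
    (EuclideanSpace.proj i : EuclideanSpace ℝ (Fin n) →L[ℝ] ℝ).hasFDerivAt.comp_hasDerivAt _ hf
  have hfirst : ∀ᶠ u in 𝓝 t, derivWithin (fun w => c w i) s u = v u i := by
    filter_upwards [hc, eventually_mem_nhds_iff.2 hs] with u hu hsu
    rw [derivWithin_of_mem_nhds hsu, (hproj hu).deriv]
  refine ⟨hfirst.self_of_nhds, ?_⟩
  rw [derivWithin_of_mem_nhds hs, Filter.EventuallyEq.deriv_eq hfirst, (hproj hv).deriv]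

variable {M : Type*} [TopologicalSpace M]
  [ChartedSpace (EuclideanSpace ℝ (Fin n)) M] [IsManifold (𝓡 n) ∞ M]
  {φ ψ : OpenPartialHomeomorph M (EuclideanSpace ℝ (Fin n))}

/-- The geodesic equation at an interior time, in vector form. -/
theorem geodesic_equation_iff (nabla : Connection n M) {τ : ℝ → M}
    {v : ℝ → EuclideanSpace ℝ (Fin n)} {a : EuclideanSpace ℝ (Fin n)} {s : Set ℝ} {t : ℝ}
    (hs : s ∈ 𝓝 t) (hc : ∀ᶠ u in 𝓝 t, HasDerivAt (fun w => φ (τ w)) (v u) u)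
    (hv : HasDerivAt v a t) :
    (∀ i : Fin n, derivWithin (fun u => derivWithin (fun v => φ (τ v) i) s u) s t
      + ∑ j : Fin n, ∑ k : Fin n, christoffel nabla φ j k i (τ t)
          * derivWithin (fun v => φ (τ v) j) s t * derivWithin (fun v => φ (τ v) k) s t = 0) ↔
      a + christoffelForm nabla φ (τ t) (v t) (v t) = 0 := by
  have hd := fun i => derivWithin_component hs hc hv i
  rw [PiLp.ext_iff]
  refine forall_congr' fun i => ?_
  rw [(hd i).2, PiLp.add_apply, christoffelForm_apply, PiLp.zero_apply]
  simp_rw [fun j => (hd j).1]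

/-- On an open set of times the one-sided derivatives are ordinary ones, which gives the form
required by the ODE lemmas. -/
theorem IsGeodesicOn.hasDerivAt_chart {nabla : Connection n M} {σ : ℝ → M} {s : Set ℝ}
    (hσ : IsGeodesicOn nabla σ s) (hφ : φ ∈ IsManifold.maximalAtlas (𝓡 n) ∞ M) {I : Set ℝ}
    (hI : IsOpen I) (hIs : I ⊆ s) (hIφ : MapsTo σ I φ.source) {t : ℝ} (ht : t ∈ I) :
    HasDerivAt (fun w => φ (σ w)) (deriv (fun w => φ (σ w)) t) t ∧
      HasDerivAt (deriv fun w => φ (σ w))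
        (-christoffelForm nabla φ (σ t) (deriv (fun w => φ (σ w)) t)
          (deriv (fun w => φ (σ w)) t)) t := by
  have hc : ContDiffOn ℝ ∞ (fun w => φ (σ w)) I := by
    rw [← contMDiffOn_iff_contDiffOn]
    exact (contMDiffOn_of_mem_maximalAtlas hφ).comp (hσ.smooth.mono hIs) hIφ
  have h1 : ∀ u ∈ I, HasDerivAt (fun w => φ (σ w)) (deriv (fun w => φ (σ w)) u) u := fun u hu =>
    ((hc.differentiableOn (by simp)).differentiableAt (hI.mem_nhds hu)).hasDerivAt
  have h2 : HasDerivAt (deriv fun w => φ (σ w)) (deriv (deriv fun w => φ (σ w)) t) t :=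
    (((hc.deriv_of_isOpen (m := ∞) hI (by simp)).differentiableOn
      (by simp)).differentiableAt (hI.mem_nhds ht)).hasDerivAt
  refine ⟨h1 t ht, ?_⟩
  have heq := (geodesic_equation_iff nabla (mem_of_superset (hI.mem_nhds ht) hIs)
    (by filter_upwards [hI.mem_nhds ht] with u hu using h1 u hu) h2).1
    (hσ.equation φ hφ t (hIs ht) (hIφ ht))
  rwa [eq_neg_of_add_eq_zero_left heq] at h2

/-- A curve that solves the geodesic equation in one chart solves it in every chart. -/
theorem geodesic_equation_of_chart (nabla : Connection n M)
    (hφ : φ ∈ IsManifold.maximalAtlas (𝓡 n) ∞ M) (hψ : ψ ∈ IsManifold.maximalAtlas (𝓡 n) ∞ M)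
    {τ : ℝ → M} {y u : ℝ → EuclideanSpace ℝ (Fin n)} {I s : Set ℝ} (hI : IsOpen I) (hIs : I ⊆ s)
    (hyφ : MapsTo y I φ.target) (hτ : ∀ t ∈ I, τ t = φ.symm (y t))
    (hy : ∀ t ∈ I, HasDerivAt y (u t) t)
    (hu : ∀ t ∈ I, HasDerivAt u (-christoffelForm nabla φ (φ.symm (y t)) (u t) (u t)) t)
    {t : ℝ} (ht : t ∈ I) (hψt : τ t ∈ ψ.source) (i : Fin n) :
    derivWithin (fun u => derivWithin (fun v => ψ (τ v) i) s u) s t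
      + ∑ j : Fin n, ∑ k : Fin n, christoffel nabla ψ j k i (τ t)
          * derivWithin (fun v => ψ (τ v) j) s t * derivWithin (fun v => ψ (τ v) k) s t = 0 := by
  set g := ψ ∘ φ.symm with hg
  have hφτ : ∀ r ∈ I, τ r ∈ φ.source := fun r hr => hτ r hr ▸ φ.map_target (hyφ hr)
  have hyτ : ∀ r ∈ I, φ (τ r) = y r := fun r hr => by rw [hτ r hr, φ.right_inv (hyφ hr)]
  have hIt : ∀ᶠ r in 𝓝 t, r ∈ I := hI.mem_nhds ht
  have hτc : ContinuousAt τ t := by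
    refine ContinuousAt.congr (f := φ.symm ∘ y) ?_ (hIt.mono fun r hr => (hτ r hr).symm)
    exact (φ.continuousAt_symm (hyφ ht)).comp (hy t ht).continuousAt
  have hψev : ∀ᶠ r in 𝓝 t, τ r ∈ ψ.source := hτc.eventually (ψ.open_source.mem_nhds hψt)
  have hgs : ∀ r ∈ I, τ r ∈ ψ.source → ContDiffAt ℝ ∞ g (y r) := fun r hr hr' =>
    hyτ r hr ▸ contDiffAt_transition hφ hψ (hφτ r hr) hr'
  have hcomp : ∀ r ∈ I, (fun w => ψ (τ w)) =ᶠ[𝓝 r] g ∘ y := fun r hr => by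
    filter_upwards [hI.mem_nhds hr] with w hw
    simp [hg, hτ w hw]
  have h1 : ∀ᶠ r in 𝓝 t, HasDerivAt (fun w => ψ (τ w)) (fderiv ℝ g (y r) (u r)) r := by
    filter_upwards [hIt, hψev] with r hr hr'
    exact (((hgs r hr hr').differentiableAt (by simp)).hasFDerivAt.comp_hasDerivAt r
      (hy r hr)).congr_of_eventuallyEq (hcomp r hr)
  have hDg : DifferentiableAt ℝ (fderiv ℝ g) (y t) :=
    ((hgs t ht hψt).fderiv_right (m := ∞) (by simp)).differentiableAt (by simp)
  -- The acceleration in `ψ` is `D²g(u, u) - Dg(Γ(u, u))`; the transformation law makes this minus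
  -- the Christoffel form of `ψ` at `Dg u`.
  have h2 := (hDg.hasFDerivAt.comp_hasDerivAt t (hy t ht)).clm_apply (hu t ht)
  have hlaw := fderiv_transition_christoffelForm nabla hφ hψ (hφτ t ht) hψt (u t) (u t)
  rw [hyτ t ht] at hlaw
  refine (geodesic_equation_iff nabla (mem_of_superset (hI.mem_nhds ht) hIs) h1 h2).2 ?_ i
  rw [← hg] at hlaw
  rw [← hτ t ht, map_neg, Function.comp_apply, hlaw]
  abel

/-- In the preferred chart at `P`, the right-hand side of the geodesic equation is smooth, and
bounded by the square of the velocity, near `P`. -/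
theorem exists_geodesic_field_bound [T2Space M] {nabla : Connection n M}
    (hnabla : CovariantDerivative.ContMDiffCovariantDerivative nabla ∞) (P : M)
    (hφ : φ = chartAt (EuclideanSpace ℝ (Fin n)) P) :
    ∃ U : Set (EuclideanSpace ℝ (Fin n)), IsOpen U ∧ φ P ∈ U ∧ U ⊆ φ.target ∧
      ContDiffOn ℝ ∞ (fun q : EuclideanSpace ℝ (Fin n) × EuclideanSpace ℝ (Fin n) =>
        -christoffelForm nabla φ (φ.symm q.1) q.2 q.2) (U ×ˢ univ) ∧
      ∃ C, ∀ y ∈ U, ∀ u, ‖-christoffelForm nabla φ (φ.symm y) u u‖ ≤ C * ‖u‖ ^ 2 := by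
  obtain ⟨W, hW, hPW, hWφ, hsm⟩ := exists_contMDiffOn_christoffelVec hnabla P
  rw [← hφ] at hWφ hsm
  have hφm : φ ∈ IsManifold.maximalAtlas (𝓡 n) ∞ M := hφ ▸ IsManifold.chart_mem_maximalAtlas P
  set U₁ := φ.target ∩ φ.symm ⁻¹' W with hU₁
  have hU₁o : IsOpen U₁ := φ.isOpen_inter_preimage_symm hW
  have hPU : φ P ∈ U₁ :=
    ⟨φ.map_source (hWφ hPW), by rw [mem_preimage, φ.left_inv (hWφ hPW)]; exact hPW⟩
  have hvec : ∀ j k, ContDiffOn ℝ ∞ (fun q => christoffelVec nabla φ j k (φ.symm q)) U₁ :=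
    fun j k => by
      rw [← contMDiffOn_iff_contDiffOn]
      exact (hsm j k).comp ((contMDiffOn_symm_of_mem_maximalAtlas hφm).mono inter_subset_left)
        fun q hq => hq.2
  -- By continuity, adding `1` to the norm at the centre gives a bound on a neighbourhood.
  set K : Fin n → Fin n → ℝ := fun j k => ‖christoffelVec nabla φ j k (φ.symm (φ P))‖ + 1 with hK
  have hbd : ∀ᶠ q in 𝓝 (φ P), ∀ j k, ‖christoffelVec nabla φ j k (φ.symm q)‖ < K j k := by
    rw [eventually_all]
    intro j
    rw [eventually_all]
    intro k
    exact ((hvec j k).continuousOn.continuousAt (hU₁o.mem_nhds hPU)).norm.eventually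
      (gt_mem_nhds (lt_add_one _))
  obtain ⟨U₂, hU₂, hU₂o, hPU₂⟩ := eventually_nhds_iff.1 hbd
  refine ⟨U₁ ∩ U₂, hU₁o.inter hU₂o, ⟨hPU, hPU₂⟩, fun q hq => hq.1.1, ?_, ∑ j, ∑ k, K j k, ?_⟩
  · refine ContDiffOn.neg (ContDiffOn.sum fun j _ => ContDiffOn.sum fun k _ => ?_)
    have hcoord : ∀ i : Fin n, ContDiff ℝ ∞
        fun q : EuclideanSpace ℝ (Fin n) × EuclideanSpace ℝ (Fin n) => q.2 i := fun i =>
      (EuclideanSpace.proj i : EuclideanSpace ℝ (Fin n) →L[ℝ] ℝ).contDiff.comp contDiff_snd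
    exact ((hcoord j).mul (hcoord k)).contDiffOn.smul
      ((hvec j k).comp contDiff_fst.contDiffOn fun q hq => hq.1.1)
  · intro y hy u
    rw [norm_neg, christoffelForm, Finset.sum_mul]
    refine (norm_sum_le _ _).trans (Finset.sum_le_sum fun j _ => ?_)
    rw [Finset.sum_mul]
    refine (norm_sum_le _ _).trans (Finset.sum_le_sum fun k _ => ?_)
    rw [norm_smul, norm_mul, mul_comm, sq]
    exact mul_le_mul (hU₂ y hy.2 j k).le
      (mul_le_mul (PiLp.norm_apply_le u j) (PiLp.norm_apply_le u k) (norm_nonneg _)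
        (norm_nonneg _)) (by positivity) (by positivity)

end Geodesics

end AffineGeometry

/-! ### Extension of the geodesic. -/

theorem lemma6 {n : ℕ} {M : Type*} [TopologicalSpace M] [T2Space M]
    [ChartedSpace (EuclideanSpace ℝ (Fin n)) M] [IsManifold (𝓡 n) ∞ M]
    (nabla : AffineGeometry.Connection n M) (hnabla : AffineGeometry.IsAffine nabla)
    (T : ℝ) (hT : 0 < T) (σ : ℝ → M) (P : M)
    (hσ : AffineGeometry.IsGeodesicOn nabla σ (Ico 0 T))
    (hlim : Tendsto σ (𝓝[<] T) (𝓝 P)) :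
    ∃ ε > 0, ∃ τ : ℝ → M,
      AffineGeometry.IsGeodesicOn nabla τ (Ico 0 (T + ε)) ∧ EqOn τ σ (Ico 0 T) := by
  obtain ⟨φ, hφP⟩ : ∃ φ, φ = chartAt (EuclideanSpace ℝ (Fin n)) P := ⟨_, rfl⟩
  have hφ : φ ∈ IsManifold.maximalAtlas (𝓡 n) ∞ M := hφP ▸ IsManifold.chart_mem_maximalAtlas P
  have hP : P ∈ φ.source := hφP ▸ mem_chart_source _ P
  obtain ⟨U, hU, hPU, hUφ, hG, C, hGC⟩ :=
    AffineGeometry.exists_geodesic_field_bound hnabla.smooth P hφP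
  have hφlim : Tendsto (fun t => φ (σ t)) (𝓝[<] T) (𝓝 (φ P)) :=
    (φ.continuousAt hP).tendsto.comp hlim
  have hnear : ∀ᶠ t in 𝓝[<] T, σ t ∈ φ.source ∧ φ (σ t) ∈ U :=
    (hlim.eventually (φ.open_source.mem_nhds hP)).and (hφlim.eventually (hU.mem_nhds hPU))
  obtain ⟨a, ha, haU⟩ := (mem_nhdsLT_iff_exists_mem_Ico_Ioo_subset hT).1 hnear
  have hsub : Ioo a T ⊆ Ico 0 T := fun t ht => ⟨ha.1.trans ht.1.le, ht.2⟩
  have hchart := fun t (ht : t ∈ Ioo a T) =>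
    hσ.hasDerivAt_chart hφ isOpen_Ioo hsub (fun r hr => (haU hr).1) ht
  obtain ⟨ε, hε, y, u, hys, hyu, hyeq⟩ := AffineGeometry.exists_extension_of_tendsto hU hG hGC ha.2
    hPU (fun t ht => (haU ht).2) (fun t ht => (hchart t ht).1)
    (fun t ht => by simpa only [φ.left_inv (haU ht).1] using (hchart t ht).2) hφlim
  -- Up to time `a` the curve `σ` may leave the chart, so `σ` itself is kept before `T`; on `(a, T)`
  -- both descriptions agree.
  obtain ⟨τ, hτl, hτr⟩ : ∃ τ : ℝ → M, (∀ t < T, τ t = σ t) ∧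
      ∀ t, T ≤ t → τ t = φ.symm (y t) :=
    ⟨fun t => if t < T then σ t else φ.symm (y t), fun t ht => if_pos ht,
      fun t ht => if_neg (not_lt.2 ht)⟩
  have hτy : ∀ t ∈ Ioo a (T + ε), τ t = φ.symm (y t) := by
    intro t ht
    rcases lt_or_ge t T with h | h
    · rw [hτl t h, hyeq ⟨ht.1, h⟩, φ.left_inv (haU ⟨ht.1, h⟩).1]
    · exact hτr t h
  have hIs : Ioo a (T + ε) ⊆ Ico 0 (T + ε) := fun t ht => ⟨ha.1.trans ht.1.le, ht.2⟩
  have hyφ : MapsTo y (Ioo a (T + ε)) φ.target := fun t ht => hUφ (hyu t ht).1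
  have hinter : Ico 0 (T + ε) ∩ Iio T = Ico 0 T := by
    rw [Ico_inter_Iio, min_eq_right (by linarith)]
  refine ⟨ε, hε, τ, ⟨?_, ?_⟩, fun t ht => hτl t ht.2⟩
  · intro t ht
    rcases lt_or_ge t T with h | h
    · rw [← contMDiffWithinAt_inter (Iio_mem_nhds h), hinter]
      exact (hσ.smooth t ⟨ht.1, h⟩).congr (fun r hr => hτl r hr.2) (hτl t h)
    · have hta : t ∈ Ioo a (T + ε) := ⟨ha.2.trans_le h, ht.2⟩
      have hcomp : ContMDiffOn 𝓘(ℝ, ℝ) (𝓡 n) ∞ (φ.symm ∘ y) (Ioo a (T + ε)) :=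
        (contMDiffOn_symm_of_mem_maximalAtlas hφ).comp hys.contMDiffOn hyφ
      exact ((hcomp.congr hτy).contMDiffAt (isOpen_Ioo.mem_nhds hta)).contMDiffWithinAt
  · intro ψ hψ t ht htψ i
    rcases lt_or_ge t T with h | h
    -- Before `T` the equation is inherited from `σ`. This case contains the end point `0`, so
    -- derivatives within the two half-open intervals are compared directly.
    · have hset : ∀ (f : ℝ → ℝ), ∀ r < T,
          derivWithin f (Ico 0 (T + ε)) r = derivWithin f (Ico 0 T) r := fun f r hr => by
        rw [← hinter, derivWithin_inter (Iio_mem_nhds hr)]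
      have hfirst : ∀ j, ∀ r ∈ Ico 0 T, derivWithin (fun v => ψ (τ v) j) (Ico 0 (T + ε)) r =
          derivWithin (fun v => ψ (σ v) j) (Ico 0 T) r := fun j r hr => by
        rw [hset _ r hr.2]
        exact derivWithin_congr (fun w hw => by simp only [hτl w hw.2])
          (by simp only [hτl r hr.2])
      have ht' : t ∈ Ico 0 T := ⟨ht.1, h⟩
      rw [hset _ t h, derivWithin_congr (hfirst i) (hfirst i t ht'), hτl t h]
      simp_rw [fun j => hfirst j t ht']
      exact hσ.equation ψ hψ t ht' (hτl t h ▸ htψ) i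
    -- Times from `T` on are interior to `(a, T + ε)`, where `τ` solves the equation in the chart
    -- `φ`.
    · exact AffineGeometry.geodesic_equation_of_chart nabla hφ hψ isOpen_Ioo hIs hyφ hτy
        (fun r hr => (hyu r hr).2.1) (fun r hr => (hyu r hr).2.2) ⟨ha.2.trans_le h, ht.2⟩ htψ i
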